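/- Let $\Omega\subseteq\mathbb R^3$ be a nonempty connected open set with coordinates $(t,x,u)$, and let $f,g$ be smooth real functions on $\Omega$ such that $g_u$ does not vanish identically on $\Omega$. Consider the nonlinear equation $$u_{tt}=u_{xx}+g(t,x,u)\,u_x+f(t,x,u).$$ Its invariance algebra is the set of all operators $Q=\tau\,\partial_t+\xi\,\partial_x+\eta\,\partial_u$ with coefficients smooth on $\Omega$ that satisfy Lie's invariance criterion: with $F=g\,u_x+f$, $$\varphi^{tt}-\varphi^{xx}-\tau F_t-\xi F_x-\eta F_u-\varphi^xF_{u_x}=0\quad\text{whenever } u_{tt}=u_{xx}+F ,$$ for all $(t,x,u)\in\Omega$ and all real values of $u_t,u_x,u_{tx},u_{xx}$, where $\varphi^t=D_t\eta-u_tD_t\tau-u_xD_t\xi$, $\varphi^x=D_x\eta-u_tD_x\tau-u_xD_x\xi$, $\varphi^{tt}=D_t\varphi^t-u_{tt}D_t\tau-u_{tx}D_t\xi$, $\varphi^{xx}=D_x\varphi^x-u_{tx}D_x\tau-u_{xx}D_x\xi$, and $D_t,D_x$ are the total derivatives. Then the invariance algebra neither is nor contains a nonzero finite-dimensional real semisimple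 Lie algebra (under the commutator of operators). Moreover, the Lie algebra of smooth first-order operators on $\Omega$ has no subalgebra that is isomorphic to $\mathfrak{so}(3)$ or to $\mathfrak{sl}(2,\mathbb R)$ and consists of operators of the form $$(\lambda t+\lambda_1)\,\partial_t+(\lambda x+\lambda_2)\,\partial_x+\bigl(h(x)\,u+r(t,x)\bigr)\,\partial_u ,$$ where $\lambda,\lambda_1,\lambda_2\in\mathbb R$ and $h,r$ are functions. -/

import Mathlib

open scoped ContDiff

/-- The space of the independent variables `t`, `x` and the dependent variable `u`;
a point is `(t, x, u)`. -/
abbrev TXU : Type := ℝ × ℝ × ℝ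

/-- Smooth vector fields on the open set `Ω`, as a vector space. So that two fields are equal exactly
when they agree on `Ω`, a field is stored as a function on the whole space that vanishes
outside `Ω`. -/
def smoothFieldSubmodule (Ω : TopologicalSpace.Opens TXU) : Submodule ℝ (TXU → TXU) where
  carrier := {V | ContDiffOn ℝ ∞ V Ω ∧ ∀ p ∉ Ω, V p = 0}
  add_mem' := fun {V W} hV hW =>
    ⟨hV.1.add hW.1, fun p hp => by simp [hV.2 p hp, hW.2 p hp]⟩
  zero_mem' := ⟨contDiffOn_const, fun _ _ => rfl⟩
  smul_mem' := fun c V hV =>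
    ⟨contDiffOn_const.smul hV.1, fun p hp => by simp [hV.2 p hp]⟩

/-- The first-order operators `Q = τ ∂_t + ξ ∂_x + η ∂_u` whose coefficients are smooth
on the open set `Ω`. -/
def SmoothField (Ω : TopologicalSpace.Opens TXU) : Type := smoothFieldSubmodule Ω

namespace SmoothField

variable {Ω : TopologicalSpace.Opens TXU}

noncomputable instance : AddCommGroup (SmoothField Ω) :=
  inferInstanceAs (AddCommGroup (smoothFieldSubmodule Ω))

noncomputable instance : Module ℝ (SmoothField Ω) :=
  inferInstanceAs (Module ℝ (smoothFieldSubmodule Ω))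

instance : CoeFun (SmoothField Ω) (fun _ => TXU → TXU) := ⟨fun Q => Q.1⟩

@[ext] theorem ext {V W : SmoothField Ω} (h : ∀ p ∈ Ω, V p = W p) : V = W := by
  apply Subtype.ext
  funext p
  by_cases hp : p ∈ Ω
  · exact h p hp
  · exact (V.2.2 p hp).trans (W.2.2 p hp).symm

theorem add_apply (V W : SmoothField Ω) (p : TXU) : (V + W) p = V p + W p := rfl

theorem smul_apply (c : ℝ) (V : SmoothField Ω) (p : TXU) : (c • V) p = c • V p := rfl

theorem zero_apply (p : TXU) : (0 : SmoothField Ω) p = 0 := rfl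

theorem contDiffAt (V : SmoothField Ω) {p : TXU} (hp : p ∈ Ω) : ContDiffAt ℝ ∞ V p :=
  V.2.1.contDiffAt (Ω.isOpen.mem_nhds hp)

theorem differentiableAt (V : SmoothField Ω) {p : TXU} (hp : p ∈ Ω) :
    DifferentiableAt ℝ V p :=
  (V.contDiffAt hp).differentiableAt (by simp)

/-- The commutator of first-order operators: at a point of `Ω` it is `DW(V) - DV(W)`. -/
noncomputable instance : Bracket (SmoothField Ω) (SmoothField Ω) where
  bracket V W := ⟨Set.indicator Ω (VectorField.lieBracket ℝ V W), by
    constructor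
    · have h : ContDiffOn ℝ ∞ (VectorField.lieBracket ℝ V W) Ω := fun p hp =>
        ((V.contDiffAt hp).lieBracket_vectorField (m := ∞) (W.contDiffAt hp)
          (by simp)).contDiffWithinAt
      exact h.congr fun p hp => Set.indicator_of_mem hp _
    · intro p hp
      exact Set.indicator_of_notMem hp _⟩

theorem bracket_apply (V W : SmoothField Ω) {p : TXU} (hp : p ∈ Ω) :
    ⁅V, W⁆ p = fderiv ℝ W p (V p) - fderiv ℝ V p (W p) := by
  exact Set.indicator_of_mem (s := (Ω : Set TXU)) hp (VectorField.lieBracket ℝ V W)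

theorem bracket_eventuallyEq (V W : SmoothField Ω) {p : TXU} (hp : p ∈ Ω) :
    (⁅V, W⁆ : SmoothField Ω) =ᶠ[nhds p] VectorField.lieBracket ℝ V W := by
  filter_upwards [Ω.isOpen.mem_nhds hp] with q hq
  exact bracket_apply V W hq

noncomputable instance : LieRing (SmoothField Ω) where
  add_lie U V W := by
    ext1 p hp
    simp only [bracket_apply _ _ hp, add_apply]
    have h : fderiv ℝ (U + V : SmoothField Ω) p = fderiv ℝ U p + fderiv ℝ V p :=
      fderiv_add (U.differentiableAt hp) (V.differentiableAt hp)
    rw [h, map_add, _root_.add_apply]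
    abel
  lie_add U V W := by
    ext1 p hp
    simp only [bracket_apply _ _ hp, add_apply]
    have h : fderiv ℝ (V + W : SmoothField Ω) p = fderiv ℝ V p + fderiv ℝ W p :=
      fderiv_add (V.differentiableAt hp) (W.differentiableAt hp)
    rw [h, map_add, _root_.add_apply]
    abel
  lie_self U := by
    ext1 p hp
    simp only [bracket_apply _ _ hp, zero_apply, sub_self]
  leibniz_lie U V W := by
    ext1 p hp
    have h2 : minSmoothness ℝ 2 ≤ (∞ : WithTop ℕ∞) := by
      simp only [minSmoothness_of_isRCLikeNormedField]
      exact WithTop.coe_le_coe.2 le_top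
    have key := VectorField.leibniz_identity_lieBracket (n := minSmoothness ℝ 2) le_rfl
      (U := U) (V := V) (W := W) (x := p)
      ((U.contDiffAt hp).of_le h2) ((V.contDiffAt hp).of_le h2) ((W.contDiffAt hp).of_le h2)
    rw [add_apply, (bracket_eventuallyEq U ⁅V, W⁆ hp).eq_of_nhds,
      (bracket_eventuallyEq ⁅U, V⁆ W hp).eq_of_nhds,
      (bracket_eventuallyEq V ⁅U, W⁆ hp).eq_of_nhds,
      Filter.EventuallyEq.lieBracket_vectorField_eq Filter.EventuallyEq.rfl
        (bracket_eventuallyEq V W hp),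
      Filter.EventuallyEq.lieBracket_vectorField_eq (bracket_eventuallyEq U V hp)
        Filter.EventuallyEq.rfl,
      Filter.EventuallyEq.lieBracket_vectorField_eq Filter.EventuallyEq.rfl
        (bracket_eventuallyEq U W hp)]
    exact key

noncomputable instance : LieAlgebra ℝ (SmoothField Ω) where
  lie_smul c V W := by
    ext1 p hp
    simp only [bracket_apply _ _ hp, smul_apply]
    have h : fderiv ℝ (c • W : SmoothField Ω) p = c • fderiv ℝ W p :=
      fderiv_const_smul (W.differentiableAt hp) c
    rw [h, map_smul, _root_.smul_apply, smul_sub]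

end SmoothField

/-- First-order jets `((t, x, u), (u_t, u_x))`. -/
abbrev Jet1 : Type := TXU × (ℝ × ℝ)

/-- Second-order jets `(((t, x, u), (u_t, u_x)), (u_tt, u_tx, u_xx))`. -/
abbrev Jet2 : Type := Jet1 × (ℝ × ℝ × ℝ)

/-- `D_t G = G_t + u_t G_u` for a function `G` of `(t, x, u)`. -/
noncomputable def totalT (G : TXU → ℝ) : Jet1 → ℝ :=
  fun ⟨p, ut, _⟩ => fderiv ℝ G p (1, 0, ut)

/-- `D_x G = G_x + u_x G_u` for a function `G` of `(t, x, u)`. -/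
noncomputable def totalX (G : TXU → ℝ) : Jet1 → ℝ :=
  fun ⟨p, _, ux⟩ => fderiv ℝ G p (0, 1, ux)

/-- `D_t P = P_t + u_t P_u + u_tt P_{u_t} + u_tx P_{u_x}` for a function `P` of first-order
jets. -/
noncomputable def totalT₁ (P : Jet1 → ℝ) : Jet2 → ℝ :=
  fun ⟨⟨p, ut, ux⟩, utt, utx, _⟩ => fderiv ℝ P (p, ut, ux) ((1, 0, ut), (utt, utx))

/-- `D_x P = P_x + u_x P_u + u_tx P_{u_t} + u_xx P_{u_x}` for a function `P` of first-order
jets. -/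
noncomputable def totalX₁ (P : Jet1 → ℝ) : Jet2 → ℝ :=
  fun ⟨⟨p, ut, ux⟩, _, utx, uxx⟩ => fderiv ℝ P (p, ut, ux) ((0, 1, ux), (utx, uxx))

section Prolongation

variable (Q : TXU → TXU)

/-- The coefficient `τ` of `Q = τ ∂_t + ξ ∂_x + η ∂_u`. -/
def coeffT : TXU → ℝ := fun p => (Q p).1

/-- The coefficient `ξ` of `Q = τ ∂_t + ξ ∂_x + η ∂_u`. -/
def coeffX : TXU → ℝ := fun p => (Q p).2.1

/-- The coefficient `η` of `Q = τ ∂_t + ξ ∂_x + η ∂_u`. -/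
def coeffU : TXU → ℝ := fun p => (Q p).2.2

/-- `φ^t = D_t η - u_t D_t τ - u_x D_t ξ`. -/
noncomputable def phiT : Jet1 → ℝ :=
  fun ⟨p, ut, ux⟩ =>
    totalT (coeffU Q) (p, ut, ux) - ut * totalT (coeffT Q) (p, ut, ux)
      - ux * totalT (coeffX Q) (p, ut, ux)

/-- `φ^x = D_x η - u_t D_x τ - u_x D_x ξ`. -/
noncomputable def phiX : Jet1 → ℝ :=
  fun ⟨p, ut, ux⟩ =>
    totalX (coeffU Q) (p, ut, ux) - ut * totalX (coeffT Q) (p, ut, ux)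
      - ux * totalX (coeffX Q) (p, ut, ux)

/-- `φ^{tt} = D_t φ^t - u_tt D_t τ - u_tx D_t ξ`. -/
noncomputable def phiTT : Jet2 → ℝ :=
  fun ⟨j, utt, utx, uxx⟩ =>
    totalT₁ (phiT Q) (j, utt, utx, uxx) - utt * totalT (coeffT Q) j - utx * totalT (coeffX Q) j

/-- `φ^{xx} = D_x φ^x - u_tx D_x τ - u_xx D_x ξ`. -/
noncomputable def phiXX : Jet2 → ℝ :=
  fun ⟨j, utt, utx, uxx⟩ =>
    totalX₁ (phiX Q) (j, utt, utx, uxx) - utx * totalX (coeffT Q) j - uxx * totalX (coeffX Q) j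

end Prolongation

/-- The right-hand side `F(t, x, u, u_x) = g(t, x, u) u_x + f(t, x, u)`, as a function of
`((t, x, u), u_x)`. -/
def waveRHS (f g : TXU → ℝ) : TXU × ℝ → ℝ := fun ⟨p, ux⟩ => g p * ux + f p

/-- Lie's invariance criterion for the equation `u_tt = u_xx + g(t,x,u) u_x + f(t,x,u)` over `Ω`:
`φ^{tt} - φ^{xx} - τ F_t - ξ F_x - η F_u - φ^x F_{u_x} = 0` whenever `u_tt = u_xx + F`. -/
def IsInvarianceOperator {Ω : TopologicalSpace.Opens TXU} (f g : TXU → ℝ)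
    (Q : SmoothField Ω) : Prop :=
  ∀ p ∈ Ω, ∀ ut ux utx uxx : ℝ,
    let F := waveRHS f g
    let j : Jet2 := ((p, ut, ux), uxx + F (p, ux), utx, uxx)
    phiTT Q j - phiXX Q j
      - coeffT Q p * fderiv ℝ F (p, ux) ((1, 0, 0), 0)
      - coeffX Q p * fderiv ℝ F (p, ux) ((0, 1, 0), 0)
      - coeffU Q p * fderiv ℝ F (p, ux) ((0, 0, 1), 0)
      - phiX Q (p, ut, ux) * fderiv ℝ F (p, ux) ((0, 0, 0), 1) = 0

/-- The invariance algebra (on `Ω`) of `u_tt = u_xx + g(t,x,u) u_x + f(t,x,u)`: the set of all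
smooth operators on `Ω` that satisfy Lie's criterion. -/
def invarianceAlgebra (Ω : TopologicalSpace.Opens TXU) (f g : TXU → ℝ) : Set (SmoothField Ω) :=
  {Q | IsInvarianceOperator f g Q}

/-- Operators of the form
`(c t + a) ∂_t + (c x + b) ∂_x + (h(x) u + r(t, x)) ∂_u` with real constants `c, a, b`.
(`h` and `r` are smooth where they matter, because the operator is smooth on the open set `Ω`.) -/
def IsAdmissibleOperator {Ω : TopologicalSpace.Opens TXU} (Q : SmoothField Ω) : Prop :=
  ∃ (c a b : ℝ) (h : ℝ → ℝ) (r : ℝ → ℝ → ℝ),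
    ∀ t x u : ℝ, (t, x, u) ∈ Ω → Q (t, x, u) = (c * t + a, c * x + b, h x * u + r t x)

/-! A semisimple Lie algebra is perfect, as are `so(3)` and `sl(2)`, so a linear functional on it
that kills all commutators is zero. Evaluation of a coefficient, or of one of its derivatives, at a
fixed point is such a candidate functional.

Where `g_u ≠ 0`, splitting Lie's criterion forces `τ = τ(t)`, `ξ = ξ(x)`, `τ_t = ξ_x` locally
constant and `η_uu = 0`; admissible operators satisfy the same equations on all of `Ω`. For such
fields the `τ` of a commutator is the Wronskian of the two `τ`'s, with zero `t`-derivative because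
`τ_tt = 0`. Perfectness then kills `τ_t`, next `τ`, and next `ξ`, since `ξ_x = τ_t`. The same
Wronskian argument in `u` kills `η_u` and `η` (`IsPerfectLie.eq_zero_of_isAffineOn`).

This only gives vanishing on the open set where `g_u ≠ 0`. Smooth fields have no unique continuation
in general, but perfectness in finite dimension supplies it (`IsPerfectLie.eq_zero_of_jet_eq_zero`):
commutators are bounded by values times first derivatives, so the fields vanish wherever the
derivatives are small enough. The set of points with zero first jet is therefore open and closed in
the connected set `Ω`. -/

/-- The derivative of `G` in the constant direction `v`, as a function. -/
noncomputable def dirDeriv (v : TXU) (G : TXU → ℝ) : TXU → ℝ := fun p => fderiv ℝ G p v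

local notation "∂t" => dirDeriv (1, 0, 0)
local notation "∂x" => dirDeriv (0, 1, 0)
local notation "∂u" => dirDeriv (0, 0, 1)

theorem dirDeriv_contDiffOn {S : Set TXU} (hS : IsOpen S) {G : TXU → ℝ}
    (hG : ContDiffOn ℝ ∞ G S) (v : TXU) : ContDiffOn ℝ ∞ (dirDeriv v G) S :=
  (hG.fderiv_of_isOpen hS (m := ∞) (by simp)).clm_apply contDiffOn_const

theorem ContDiffOn.differentiableAt_of_isOpen {S : Set TXU} (hS : IsOpen S) {G : TXU → ℝ}
    (hG : ContDiffOn ℝ ∞ G S) {p : TXU} (hp : p ∈ S) : DifferentiableAt ℝ G p :=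
  (hG.contDiffAt (hS.mem_nhds hp)).differentiableAt (by simp)

theorem dirDeriv_comm {S : Set TXU} (hS : IsOpen S) {G : TXU → ℝ}
    (hG : ContDiffOn ℝ ∞ G S) (v w : TXU) {p : TXU} (hp : p ∈ S) :
    dirDeriv v (dirDeriv w G) p = dirDeriv w (dirDeriv v G) p := by
  have hd : DifferentiableAt ℝ (fderiv ℝ G) p :=
    ((hG.fderiv_of_isOpen hS (m := ∞) (by simp)).contDiffAt (hS.mem_nhds hp)).differentiableAt
      (by simp)
  have key : ∀ a b : TXU, dirDeriv a (dirDeriv b G) p = fderiv ℝ (fderiv ℝ G) p a b := by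
    intro a b
    have h := (hd.hasFDerivAt.clm_apply (hasFDerivAt_const b p)).fderiv
    change fderiv ℝ (fun q => fderiv ℝ G q b) p a = _
    rw [h]
    simp
  have hs : IsSymmSndFDerivAt ℝ G p :=
    (hG.contDiffAt (hS.mem_nhds hp)).isSymmSndFDerivAt (by
      simp only [minSmoothness_of_isRCLikeNormedField]
      exact WithTop.coe_le_coe.2 le_top)
  rw [key, key]
  exact hs v w

theorem dirDeriv_eqOn {S : Set TXU} (hS : IsOpen S) {G H : TXU → ℝ} (h : Set.EqOn G H S)
    (v : TXU) : Set.EqOn (dirDeriv v G) (dirDeriv v H) S := fun p hp => by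
  have : G =ᶠ[nhds p] H := Filter.eventuallyEq_of_mem (hS.mem_nhds hp) h
  simp only [dirDeriv, this.fderiv_eq]

theorem dirDeriv_eq_zero {S : Set TXU} (hS : IsOpen S) {G : TXU → ℝ} (h : ∀ p ∈ S, G p = 0)
    (v : TXU) {p : TXU} (hp : p ∈ S) : dirDeriv v G p = 0 := by
  rw [dirDeriv_eqOn hS (H := fun _ => 0) h v hp]
  simp [dirDeriv]

theorem fderiv_eq_dirDeriv (G : TXU → ℝ) (p : TXU) (a b c : ℝ) :
    fderiv ℝ G p (a, b, c) = a * ∂t G p + b * ∂x G p + c * ∂u G p := by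
  have : ((a, b, c) : TXU) = a • (1, 0, 0) + b • (0, 1, 0) + c • (0, 0, 1) := by simp
  rw [this]
  simp only [map_add, map_smul, smul_eq_mul, dirDeriv]

/-! ### Explicit second prolongation. -/

section Coefficients

variable {Ω : TopologicalSpace.Opens TXU} (Q : SmoothField Ω)

theorem coeffT_contDiffOn : ContDiffOn ℝ ∞ (coeffT Q) Ω := contDiff_fst.comp_contDiffOn Q.2.1

theorem coeffX_contDiffOn : ContDiffOn ℝ ∞ (coeffX Q) Ω :=
  contDiff_fst.comp_contDiffOn (contDiff_snd.comp_contDiffOn Q.2.1)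

theorem coeffU_contDiffOn : ContDiffOn ℝ ∞ (coeffU Q) Ω :=
  contDiff_snd.comp_contDiffOn (contDiff_snd.comp_contDiffOn Q.2.1)

theorem hasFDerivAt_dirDeriv_fst {G : TXU → ℝ} (hG : ContDiffOn ℝ ∞ G Ω) (v : TXU) {p : TXU}
    (hp : p ∈ Ω) (z : ℝ × ℝ) :
    HasFDerivAt (fun j : Jet1 => dirDeriv v G j.1)
      ((fderiv ℝ (dirDeriv v G) p).comp (ContinuousLinearMap.fst ℝ TXU (ℝ × ℝ))) (p, z) :=
  HasFDerivAt.comp (p, z) (f := (Prod.fst : Jet1 → TXU))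
    ((dirDeriv_contDiffOn Ω.isOpen hG v).differentiableAt_of_isOpen Ω.isOpen hp).hasFDerivAt
    hasFDerivAt_fst

/-- The derivative of a first prolongation coefficient: `v + m ∂_u` with the jet coordinate `m`
in place of `u_t` or `u_x` is the direction of the total derivative. -/
theorem fderiv_prolongation (v : TXU) (m : Jet1 →L[ℝ] ℝ) {p : TXU} (hp : p ∈ Ω) (ut ux : ℝ)
    (e : Jet1) :
    fderiv ℝ (fun j : Jet1 =>
      (dirDeriv v (coeffU Q) j.1 + m j * ∂u (coeffU Q) j.1)
        - j.2.1 * (dirDeriv v (coeffT Q) j.1 + m j * ∂u (coeffT Q) j.1)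
        - j.2.2 * (dirDeriv v (coeffX Q) j.1 + m j * ∂u (coeffX Q) j.1)) (p, ut, ux) e
    = (fderiv ℝ (dirDeriv v (coeffU Q)) p e.1 + m (p, ut, ux) * fderiv ℝ (∂u (coeffU Q)) p e.1
        + m e * ∂u (coeffU Q) p)
      - ut * (fderiv ℝ (dirDeriv v (coeffT Q)) p e.1
        + m (p, ut, ux) * fderiv ℝ (∂u (coeffT Q)) p e.1 + m e * ∂u (coeffT Q) p)
      - e.2.1 * (dirDeriv v (coeffT Q) p + m (p, ut, ux) * ∂u (coeffT Q) p)
      - ux * (fderiv ℝ (dirDeriv v (coeffX Q)) p e.1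
        + m (p, ut, ux) * fderiv ℝ (∂u (coeffX Q)) p e.1 + m e * ∂u (coeffX Q) p)
      - e.2.2 * (dirDeriv v (coeffX Q) p + m (p, ut, ux) * ∂u (coeffX Q) p) := by
  have hm : HasFDerivAt (fun j : Jet1 => m j) m (p, ut, ux) := m.hasFDerivAt
  have hut : HasFDerivAt (fun j : Jet1 => j.2.1) _ (p, ut, ux) :=
    ((ContinuousLinearMap.fst ℝ ℝ ℝ).comp (ContinuousLinearMap.snd ℝ TXU (ℝ × ℝ))).hasFDerivAt
  have hux : HasFDerivAt (fun j : Jet1 => j.2.2) _ (p, ut, ux) :=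
    ((ContinuousLinearMap.snd ℝ ℝ ℝ).comp (ContinuousLinearMap.snd ℝ TXU (ℝ × ℝ))).hasFDerivAt
  have part : ∀ {G : TXU → ℝ}, ContDiffOn ℝ ∞ G Ω →
      HasFDerivAt (fun j : Jet1 => dirDeriv v G j.1 + m j * ∂u G j.1) _ (p, ut, ux) :=
    fun hG => (hasFDerivAt_dirDeriv_fst hG v hp (ut, ux)).add
      (hm.mul (hasFDerivAt_dirDeriv_fst hG (0, 0, 1) hp (ut, ux)))
  have h := ((part (coeffU_contDiffOn Q)).sub (hut.mul (part (coeffT_contDiffOn Q)))).sub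
    (hux.mul (part (coeffX_contDiffOn Q)))
  refine (congrArg (fun T : Jet1 →L[ℝ] ℝ => T e) h.fderiv).trans ?_
  simp
  ring

theorem phiT_eq : phiT Q = fun j : Jet1 =>
      (∂t (coeffU Q) j.1 + j.2.1 * ∂u (coeffU Q) j.1)
        - j.2.1 * (∂t (coeffT Q) j.1 + j.2.1 * ∂u (coeffT Q) j.1)
        - j.2.2 * (∂t (coeffX Q) j.1 + j.2.1 * ∂u (coeffX Q) j.1) := by
  funext ⟨p, ut, ux⟩
  simp only [phiT, totalT, fderiv_eq_dirDeriv]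
  ring

theorem phiX_eq : phiX Q = fun j : Jet1 =>
      (∂x (coeffU Q) j.1 + j.2.2 * ∂u (coeffU Q) j.1)
        - j.2.1 * (∂x (coeffT Q) j.1 + j.2.2 * ∂u (coeffT Q) j.1)
        - j.2.2 * (∂x (coeffX Q) j.1 + j.2.2 * ∂u (coeffX Q) j.1) := by
  funext ⟨p, ut, ux⟩
  simp only [phiX, totalX, fderiv_eq_dirDeriv]
  ring

theorem totalT₁_phiT {p : TXU} (hp : p ∈ Ω) (ut ux utt utx uxx : ℝ) :
    totalT₁ (phiT Q) ((p, ut, ux), utt, utx, uxx)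
    = (∂t (∂t (coeffU Q)) p + 2 * ut * ∂t (∂u (coeffU Q)) p + ut ^ 2 * ∂u (∂u (coeffU Q)) p
        + utt * ∂u (coeffU Q) p)
      - ut * (∂t (∂t (coeffT Q)) p + 2 * ut * ∂t (∂u (coeffT Q)) p
        + ut ^ 2 * ∂u (∂u (coeffT Q)) p + utt * ∂u (coeffT Q) p)
      - utt * (∂t (coeffT Q) p + ut * ∂u (coeffT Q) p)
      - ux * (∂t (∂t (coeffX Q)) p + 2 * ut * ∂t (∂u (coeffX Q)) p
        + ut ^ 2 * ∂u (∂u (coeffX Q)) p + utt * ∂u (coeffX Q) p)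
      - utx * (∂t (coeffX Q) p + ut * ∂u (coeffX Q) p) := by
  have h := fderiv_prolongation Q (1, 0, 0)
    ((ContinuousLinearMap.fst ℝ ℝ ℝ).comp (ContinuousLinearMap.snd ℝ TXU (ℝ × ℝ))) hp ut ux
    ((1, 0, ut), (utt, utx))
  simp only [totalT₁, phiT_eq]
  refine h.trans ?_
  simp only [fderiv_eq_dirDeriv, ContinuousLinearMap.comp_apply, ContinuousLinearMap.coe_fst',
    ContinuousLinearMap.coe_snd',
    dirDeriv_comm Ω.isOpen (coeffU_contDiffOn Q) (0, 0, 1) (1, 0, 0) hp,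
    dirDeriv_comm Ω.isOpen (coeffT_contDiffOn Q) (0, 0, 1) (1, 0, 0) hp,
    dirDeriv_comm Ω.isOpen (coeffX_contDiffOn Q) (0, 0, 1) (1, 0, 0) hp]
  ring

theorem totalX₁_phiX {p : TXU} (hp : p ∈ Ω) (ut ux utt utx uxx : ℝ) :
    totalX₁ (phiX Q) ((p, ut, ux), utt, utx, uxx)
    = (∂x (∂x (coeffU Q)) p + 2 * ux * ∂x (∂u (coeffU Q)) p + ux ^ 2 * ∂u (∂u (coeffU Q)) p
        + uxx * ∂u (coeffU Q) p)
      - ut * (∂x (∂x (coeffT Q)) p + 2 * ux * ∂x (∂u (coeffT Q)) p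
        + ux ^ 2 * ∂u (∂u (coeffT Q)) p + uxx * ∂u (coeffT Q) p)
      - utx * (∂x (coeffT Q) p + ux * ∂u (coeffT Q) p)
      - ux * (∂x (∂x (coeffX Q)) p + 2 * ux * ∂x (∂u (coeffX Q)) p
        + ux ^ 2 * ∂u (∂u (coeffX Q)) p + uxx * ∂u (coeffX Q) p)
      - uxx * (∂x (coeffX Q) p + ux * ∂u (coeffX Q) p) := by
  have h := fderiv_prolongation Q (0, 1, 0)
    ((ContinuousLinearMap.snd ℝ ℝ ℝ).comp (ContinuousLinearMap.snd ℝ TXU (ℝ × ℝ))) hp ut ux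
    ((0, 1, ux), (utx, uxx))
  simp only [totalX₁, phiX_eq]
  refine h.trans ?_
  simp only [fderiv_eq_dirDeriv, ContinuousLinearMap.comp_apply,
    ContinuousLinearMap.coe_snd',
    dirDeriv_comm Ω.isOpen (coeffU_contDiffOn Q) (0, 0, 1) (0, 1, 0) hp,
    dirDeriv_comm Ω.isOpen (coeffT_contDiffOn Q) (0, 0, 1) (0, 1, 0) hp,
    dirDeriv_comm Ω.isOpen (coeffX_contDiffOn Q) (0, 0, 1) (0, 1, 0) hp]
  ring

end Coefficients

/-! ### Determining equations and the affine form of operators. -/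

theorem fderiv_waveRHS_snd {f g : TXU → ℝ} {p : TXU} (hf : DifferentiableAt ℝ f p)
    (hg : DifferentiableAt ℝ g p) (ux : ℝ) :
    fderiv ℝ (waveRHS f g) (p, ux) ((0, 0, 0), 1) = g p := by
  have hF : HasFDerivAt (fun q : TXU × ℝ => g q.1 * q.2 + f q.1) _ (p, ux) :=
    ((HasFDerivAt.comp (p, ux) (f := (Prod.fst : TXU × ℝ → TXU)) hg.hasFDerivAt
      hasFDerivAt_fst).mul hasFDerivAt_snd).add
    (HasFDerivAt.comp (p, ux) (f := (Prod.fst : TXU × ℝ → TXU)) hf.hasFDerivAt hasFDerivAt_fst)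
  refine (congrArg (fun T : TXU × ℝ →L[ℝ] ℝ => T ((0, 0, 0), 1)) hF.fderiv).trans ?_
  have h0 : ((0, 0, 0) : TXU) = 0 := rfl
  simp [h0]

/-- The determining equations that do not involve the derivatives of `f` and `g`. -/
theorem IsInvarianceOperator.determining {Ω : TopologicalSpace.Opens TXU} {f g : TXU → ℝ}
    (hf : ContDiffOn ℝ ∞ f Ω) (hg : ContDiffOn ℝ ∞ g Ω) {Q : SmoothField Ω}
    (hQ : IsInvarianceOperator f g Q) :
    (∀ p ∈ Ω, ∂u (coeffT Q) p = 0) ∧ (∀ p ∈ Ω, ∂u (coeffX Q) p = 0) ∧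
    (∀ p ∈ Ω, ∂t (coeffX Q) p = ∂x (coeffT Q) p) ∧
    (∀ p ∈ Ω, ∂t (coeffT Q) p = ∂x (coeffX Q) p) ∧
    (∀ p ∈ Ω, ∂u (∂u (coeffU Q)) p = 0) ∧
    (∀ p ∈ Ω, 2 * ∂t (∂u (coeffU Q)) p + g p * ∂x (coeffT Q) p = 0) := by
  -- `R` absorbs every remaining term depending on `ux` alone, including all derivatives of `f` and
  -- `g`; it cancels in differences taken at fixed `ux`.
  have expand : ∀ p ∈ Ω, ∃ R : ℝ → ℝ, ∀ ut ux utx uxx : ℝ,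
      totalT₁ (phiT Q) ((p, ut, ux), uxx + (g p * ux + f p), utx, uxx)
        - (uxx + (g p * ux + f p)) * (∂t (coeffT Q) p + ut * ∂u (coeffT Q) p)
        - utx * (∂t (coeffX Q) p + ut * ∂u (coeffX Q) p)
      - (totalX₁ (phiX Q) ((p, ut, ux), uxx + (g p * ux + f p), utx, uxx)
        - utx * (∂x (coeffT Q) p + ux * ∂u (coeffT Q) p)
        - uxx * (∂x (coeffX Q) p + ux * ∂u (coeffX Q) p))
      + ut * (∂x (coeffT Q) p + ux * ∂u (coeffT Q) p) * g p + R ux = 0 := by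
    intro p hp
    refine ⟨fun ux => - coeffT Q p * fderiv ℝ (waveRHS f g) (p, ux) ((1, 0, 0), 0)
      - coeffX Q p * fderiv ℝ (waveRHS f g) (p, ux) ((0, 1, 0), 0)
      - coeffU Q p * fderiv ℝ (waveRHS f g) (p, ux) ((0, 0, 1), 0)
      - (∂x (coeffU Q) p + ux * ∂u (coeffU Q) p
        - ux * (∂x (coeffX Q) p + ux * ∂u (coeffX Q) p)) * g p, fun ut ux utx uxx => ?_⟩
    have h := hQ p hp ut ux utx uxx
    dsimp only at h
    rw [fderiv_waveRHS_snd (hf.differentiableAt_of_isOpen Ω.isOpen hp)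
      (hg.differentiableAt_of_isOpen Ω.isOpen hp)] at h
    have hphi : phiX Q (p, ut, ux) = _ := congrFun (phiX_eq Q) (p, ut, ux)
    rw [hphi] at h
    simp only [phiTT, phiXX, totalT, totalX, fderiv_eq_dirDeriv] at h
    have hF : waveRHS f g (p, ux) = g p * ux + f p := rfl
    rw [hF] at h
    linear_combination h
  have hut : ∀ p ∈ Ω, ∂u (coeffT Q) p = 0 ∧ ∂u (coeffX Q) p = 0 ∧
      ∂t (coeffX Q) p = ∂x (coeffT Q) p ∧ ∂t (coeffT Q) p = ∂x (coeffX Q) p := by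
    intro p hp
    obtain ⟨R, h⟩ := expand p hp
    simp only [totalT₁_phiT Q hp, totalX₁_phiX Q hp] at h
    -- The differences isolate the coefficient of `utx` at `(ut, ux) = (0, 0), (1, 0), (0, 1)`, and
    -- at the end that of `uxx` at the origin.
    have h1 : ∂t (coeffX Q) p = ∂x (coeffT Q) p := by
      linear_combination (-1 / 2) * h 0 0 1 0 + (1 / 2) * h 0 0 0 0
    have h2 : ∂u (coeffX Q) p = 0 := by
      linear_combination (-1 / 2) * h 1 0 1 0 + (1 / 2) * h 1 0 0 0 - h1
    have h3 : ∂u (coeffT Q) p = 0 := by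
      linear_combination (1 / 2) * h 0 1 1 0 - (1 / 2) * h 0 1 0 0 + h1
    refine ⟨h3, h2, h1, ?_⟩
    linear_combination (-1 / 2) * h 0 0 0 1 + (1 / 2) * h 0 0 0 0
  have hTu : ∀ p ∈ Ω, ∂u (coeffT Q) p = 0 := fun p hp => (hut p hp).1
  have hXu : ∀ p ∈ Ω, ∂u (coeffX Q) p = 0 := fun p hp => (hut p hp).2.1
  have hXt : ∀ p ∈ Ω, ∂t (coeffX Q) p = ∂x (coeffT Q) p := fun p hp => (hut p hp).2.2.1
  have hTt : ∀ p ∈ Ω, ∂t (coeffT Q) p = ∂x (coeffX Q) p := fun p hp => (hut p hp).2.2.2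
  -- `τ_tt = ξ_xt = ξ_tx = τ_xx`; this removes the second derivatives of `τ` from the coefficient of
  -- `ut`.
  have wave : ∀ p ∈ Ω, ∂t (∂t (coeffT Q)) p = ∂x (∂x (coeffT Q)) p := by
    intro p hp
    rw [dirDeriv_eqOn Ω.isOpen hTt _ hp,
      dirDeriv_comm Ω.isOpen (coeffX_contDiffOn Q) _ _ hp, dirDeriv_eqOn Ω.isOpen hXt _ hp]
  refine ⟨hTu, hXu, hXt, hTt, fun p hp => ?_, fun p hp => ?_⟩ <;>
  · obtain ⟨R, h⟩ := expand p hp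
    simp only [totalT₁_phiT Q hp, totalX₁_phiX Q hp, hTu p hp, hXu p hp,
      dirDeriv_eq_zero Ω.isOpen hTu _ hp, dirDeriv_eq_zero Ω.isOpen hXu _ hp, wave p hp] at h
    -- The second difference in `ut` at `ux = 0` gives `η_uu`; the odd part gives the equation with
    -- `g τ_x`.
    first
    | linear_combination (1 / 2) * h 1 0 0 0 + (1 / 2) * h (-1) 0 0 0 - h 0 0 0 0
    | linear_combination (1 / 2) * h 1 0 0 0 - (1 / 2) * h (-1) 0 0 0

/-- On `S`, the field has the form
`(c t + a) ∂_t + (c x + b) ∂_x + (h(t,x) u + r(t,x)) ∂_u` up to integration. -/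
structure IsAffineOn {Ω : TopologicalSpace.Opens TXU} (S : Set TXU) (Q : SmoothField Ω) :
    Prop where
  Tx : ∀ p ∈ S, ∂x (coeffT Q) p = 0
  Tu : ∀ p ∈ S, ∂u (coeffT Q) p = 0
  Xt : ∀ p ∈ S, ∂t (coeffX Q) p = 0
  Xu : ∀ p ∈ S, ∂u (coeffX Q) p = 0
  TtXx : ∀ p ∈ S, ∂t (coeffT Q) p = ∂x (coeffX Q) p
  Ttt : ∀ p ∈ S, ∂t (∂t (coeffT Q)) p = 0
  Uuu : ∀ p ∈ S, ∂u (∂u (coeffU Q)) p = 0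

theorem IsInvarianceOperator.isAffineOn {Ω : TopologicalSpace.Opens TXU} {f g : TXU → ℝ}
    (hf : ContDiffOn ℝ ∞ f Ω) (hg : ContDiffOn ℝ ∞ g Ω) {Q : SmoothField Ω}
    (hQ : IsInvarianceOperator f g Q) {S : Set TXU} (hS : IsOpen S) (hSΩ : S ⊆ Ω)
    (hgu : ∀ p ∈ S, ∂u g p ≠ 0) : IsAffineOn S Q := by
  obtain ⟨hTu, hXu, hXt, hTt, hUuu, hUtu⟩ := hQ.determining hf hg
  have hT := coeffT_contDiffOn Q
  have hX := coeffX_contDiffOn Q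
  have hU := coeffU_contDiffOn Q
  -- Differentiating `2 η_tu + g τ_x = 0` in `u`, with `η_uu = 0` and `τ_u = 0`, leaves `g_u τ_x =
  -- 0`.
  have hTx : ∀ p ∈ S, ∂x (coeffT Q) p = 0 := by
    intro p hp
    have hpΩ := hSΩ hp
    have h1 := dirDeriv_eq_zero Ω.isOpen hUtu (0, 0, 1) hpΩ
    have dU := (dirDeriv_contDiffOn Ω.isOpen (dirDeriv_contDiffOn Ω.isOpen hU (0, 0, 1))
      (1, 0, 0)).differentiableAt_of_isOpen Ω.isOpen hpΩ
    have dT := (dirDeriv_contDiffOn Ω.isOpen hT (0, 1, 0)).differentiableAt_of_isOpen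
      Ω.isOpen hpΩ
    have dg := hg.differentiableAt_of_isOpen Ω.isOpen hpΩ
    have h2 : ∂u (fun p => 2 * ∂t (∂u (coeffU Q)) p + g p * ∂x (coeffT Q) p) p
        = 2 * ∂u (∂t (∂u (coeffU Q))) p
          + (g p * ∂u (∂x (coeffT Q)) p + ∂x (coeffT Q) p * ∂u g p) := by
      refine (congrArg (fun T : TXU →L[ℝ] ℝ => T (0, 0, 1))
        ((dU.hasFDerivAt.const_mul 2).add (dg.hasFDerivAt.mul dT.hasFDerivAt)).fderiv).trans ?_
      simp [dirDeriv]
    rw [h2, dirDeriv_comm Ω.isOpen (dirDeriv_contDiffOn Ω.isOpen hU (0, 0, 1)) _ _ hpΩ,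
      dirDeriv_eq_zero Ω.isOpen hUuu _ hpΩ, dirDeriv_comm Ω.isOpen hT _ _ hpΩ,
      dirDeriv_eq_zero Ω.isOpen hTu _ hpΩ] at h1
    have h3 : ∂x (coeffT Q) p * ∂u g p = 0 := by linear_combination h1
    exact (mul_eq_zero.1 h3).resolve_right (hgu p hp)
  have hXt' : ∀ p ∈ S, ∂t (coeffX Q) p = 0 := fun p hp => (hXt p (hSΩ hp)).trans (hTx p hp)
  exact
    { Tx := hTx
      Tu := fun p hp => hTu p (hSΩ hp)
      Xt := hXt'
      Xu := fun p hp => hXu p (hSΩ hp)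
      TtXx := fun p hp => hTt p (hSΩ hp)
      Ttt := fun p hp => by
        rw [dirDeriv_eqOn Ω.isOpen hTt _ (hSΩ hp), dirDeriv_comm Ω.isOpen hX _ _ (hSΩ hp),
          dirDeriv_eq_zero hS hXt' _ hp]
      Uuu := fun p hp => hUuu p (hSΩ hp) }

/-- Only the restriction of `G` to the line through `p` is compared with `k`, so a formula for `G`
may involve functions of the other variables with no known regularity. -/
theorem dirDeriv_eq_of_hasDerivAt {S : Set TXU} (hS : IsOpen S) {G : TXU → ℝ}
    (hG : ContDiffOn ℝ ∞ G S) {p : TXU} (hp : p ∈ S) (v : TXU) {k : ℝ → ℝ} {d : ℝ}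
    (hk : HasDerivAt k d 0) (h : ∀ s : ℝ, p + s • v ∈ S → G (p + s • v) = k s) :
    dirDeriv v G p = d := by
  have hline : HasDerivAt (fun s : ℝ => p + s • v) v 0 := by
    simpa using ((hasDerivAt_id (0 : ℝ)).smul_const v).const_add p
  have hp0 : p + (0 : ℝ) • v = p := by simp
  have hd : HasFDerivAt G (fderiv ℝ G p) (p + (0 : ℝ) • v) := by
    rw [hp0]
    exact (hG.differentiableAt_of_isOpen hS hp).hasFDerivAt
  have h1 : HasDerivAt (fun s : ℝ => G (p + s • v)) (fderiv ℝ G p v) 0 :=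
    hd.comp_hasDerivAt (0 : ℝ) hline
  have hev : (fun s : ℝ => G (p + s • v)) =ᶠ[nhds 0] k := by
    have : ∀ᶠ s in nhds (0 : ℝ), p + s • v ∈ S :=
      hline.continuousAt.eventually_mem (by rw [hp0]; exact hS.mem_nhds hp)
    filter_upwards [this] with s hs using h s hs
  exact h1.unique (hk.congr_of_eventuallyEq hev)

/-- The functions `h` and `r` are arbitrary, but the only derivatives of `η` involved are along `u`,
where `h x` and `r t x` are constants. -/
theorem IsAdmissibleOperator.isAffineOn {Ω : TopologicalSpace.Opens TXU} {Q : SmoothField Ω}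
    (hQ : IsAdmissibleOperator Q) : IsAffineOn Ω Q := by
  obtain ⟨c, a, b, h, r, hQ⟩ := hQ
  have hT := coeffT_contDiffOn Q
  have hX := coeffX_contDiffOn Q
  have hU := coeffU_contDiffOn Q
  have eT : ∀ t x u : ℝ, (t, x, u) ∈ Ω → coeffT Q (t, x, u) = c * t + a :=
    fun t x u hp => congrArg Prod.fst (hQ t x u hp)
  have eX : ∀ t x u : ℝ, (t, x, u) ∈ Ω → coeffX Q (t, x, u) = c * x + b :=
    fun t x u hp => congrArg (fun q => q.2.1) (hQ t x u hp)
  have eU : ∀ t x u : ℝ, (t, x, u) ∈ Ω → coeffU Q (t, x, u) = h x * u + r t x :=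
    fun t x u hp => congrArg (fun q => q.2.2) (hQ t x u hp)
  have lin : ∀ α β γ : ℝ, HasDerivAt (fun s : ℝ => α * (β + s) + γ) α 0 := fun α β γ => by
    simpa using (((hasDerivAt_id (0 : ℝ)).const_add β).const_mul α).add_const γ
  have hTt : ∀ p ∈ (Ω : Set TXU), ∂t (coeffT Q) p = c := fun ⟨t, x, u⟩ hp =>
    dirDeriv_eq_of_hasDerivAt Ω.isOpen hT hp _ (lin c t a) fun s hs => by
      have := eT (t + s * 1) (x + s * 0) (u + s * 0) hs
      simpa using this
  have hXx : ∀ p ∈ (Ω : Set TXU), ∂x (coeffX Q) p = c := fun ⟨t, x, u⟩ hp =>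
    dirDeriv_eq_of_hasDerivAt Ω.isOpen hX hp _ (lin c x b) fun s hs => by
      have := eX (t + s * 0) (x + s * 1) (u + s * 0) hs
      simpa using this
  have hUu : ∀ p ∈ (Ω : Set TXU), ∂u (coeffU Q) p = h p.2.1 := fun ⟨t, x, u⟩ hp =>
    dirDeriv_eq_of_hasDerivAt Ω.isOpen hU hp _ (lin (h x) u (r t x)) fun s hs => by
      have := eU (t + s * 0) (x + s * 0) (u + s * 1) hs
      simpa using this
  exact
    { Tx := fun ⟨t, x, u⟩ hp =>
        dirDeriv_eq_of_hasDerivAt Ω.isOpen hT hp _ (hasDerivAt_const 0 (c * t + a))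
          fun s hs => by
            have := eT (t + s * 0) (x + s * 1) (u + s * 0) hs
            simpa using this
      Tu := fun ⟨t, x, u⟩ hp =>
        dirDeriv_eq_of_hasDerivAt Ω.isOpen hT hp _ (hasDerivAt_const 0 (c * t + a))
          fun s hs => by
            have := eT (t + s * 0) (x + s * 0) (u + s * 1) hs
            simpa using this
      Xt := fun ⟨t, x, u⟩ hp =>
        dirDeriv_eq_of_hasDerivAt Ω.isOpen hX hp _ (hasDerivAt_const 0 (c * x + b))
          fun s hs => by
            have := eX (t + s * 1) (x + s * 0) (u + s * 0) hs
            simpa using this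
      Xu := fun ⟨t, x, u⟩ hp =>
        dirDeriv_eq_of_hasDerivAt Ω.isOpen hX hp _ (hasDerivAt_const 0 (c * x + b))
          fun s hs => by
            have := eX (t + s * 0) (x + s * 0) (u + s * 1) hs
            simpa using this
      TtXx := fun p hp => (hTt p hp).trans (hXx p hp).symm
      Ttt := fun p hp => by
        rw [dirDeriv_eqOn Ω.isOpen (H := fun _ => c) hTt _ hp]
        simp [dirDeriv]
      Uuu := fun ⟨t, x, u⟩ hp =>
        dirDeriv_eq_of_hasDerivAt Ω.isOpen (dirDeriv_contDiffOn Ω.isOpen hU _) hp _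
          (hasDerivAt_const 0 (h x)) fun s hs => by
            have := hUu (t + s * 0, x + s * 0, u + s * 1) hs
            simpa using this }

/-! ### Perfect Lie algebras. -/

/-- A real Lie algebra is perfect when it is spanned by its commutators. -/
def IsPerfectLie (L : Type*) [LieRing L] [LieAlgebra ℝ L] : Prop :=
  ∀ N : Submodule ℝ L, (∀ x y : L, ⁅x, y⁆ ∈ N) → N = ⊤

theorem IsPerfectLie.induction {L : Type*} [LieRing L] [LieAlgebra ℝ L] (hL : IsPerfectLie L)
    {P : L → Prop} (zero : P 0) (add : ∀ x y, P x → P y → P (x + y))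
    (smul : ∀ (c : ℝ) x, P x → P (c • x)) (lie : ∀ x y : L, P ⁅x, y⁆) (x : L) : P x := by
  let N : Submodule ℝ L :=
    { carrier := {x | P x}
      add_mem' := fun {a b} ha hb => add a b ha hb
      zero_mem' := zero
      smul_mem' := fun c {x} hx => smul c x hx }
  have hN : N = ⊤ := hL N lie
  have hx : x ∈ N := hN ▸ Submodule.mem_top
  exact hx

theorem IsPerfectLie.linearMap_eq_zero {L : Type*} [LieRing L] [LieAlgebra ℝ L]
    (hL : IsPerfectLie L) {M : Type*} [AddCommGroup M] [Module ℝ M] (T : L →ₗ[ℝ] M)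
    (h : ∀ x y : L, T ⁅x, y⁆ = 0) (x : L) : T x = 0 := by
  have hx : x ∈ LinearMap.ker T := (hL (LinearMap.ker T) h) ▸ Submodule.mem_top
  exact hx

/-- A minimal ideal `I` is non-abelian, so `⁅I, I⁆` is a nonzero ideal inside it and equals `I`; the
minimal ideals span. -/
theorem LieAlgebra.IsSemisimple.isPerfectLie {L : Type*} [LieRing L] [LieAlgebra ℝ L]
    [LieAlgebra.IsSemisimple ℝ L] : IsPerfectLie L := by
  intro N hN
  have htop : (⁅(⊤ : LieIdeal ℝ L), (⊤ : LieIdeal ℝ L)⁆ : LieIdeal ℝ L) = ⊤ := by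
    rw [eq_top_iff]
    refine (LieAlgebra.IsSemisimple.sSup_atoms_eq_top (R := ℝ) (L := L)).ge.trans
      (sSup_le fun I hI => ?_)
    have hle : ⁅I, I⁆ ≤ I := LieSubmodule.lie_le_right I I
    have hne : ⁅I, I⁆ ≠ ⊥ := fun h =>
      LieAlgebra.IsSemisimple.non_abelian_of_isAtom (R := ℝ) I hI
        ((LieSubmodule.lie_abelian_iff_lie_self_eq_bot I).2 h)
    rcases hI.le_iff.1 hle with h | h
    · exact absurd h hne
    · calc I = ⁅I, I⁆ := h.symm
        _ ≤ ⁅(⊤ : LieIdeal ℝ L), (⊤ : LieIdeal ℝ L)⁆ := LieSubmodule.mono_lie le_top le_top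
  have hspan := LieSubmodule.lieIdeal_oper_eq_linear_span' (R := ℝ)
    (⊤ : LieIdeal ℝ L) (⊤ : LieIdeal ℝ L)
  rw [htop, LieSubmodule.top_toSubmodule] at hspan
  rw [eq_top_iff, hspan, Submodule.span_le]
  rintro _ ⟨x, -, y, -, rfl⟩
  exact hN x y

theorem isPerfectLie_sl_two : IsPerfectLie (LieAlgebra.SpecialLinear.sl (Fin 2) ℝ) := by
  intro N hN
  rw [eq_top_iff]
  rintro ⟨A, hA⟩ -
  have mem : ∀ {B : Matrix (Fin 2) (Fin 2) ℝ}, B.trace = 0 →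
      B ∈ LieAlgebra.SpecialLinear.sl (Fin 2) ℝ := fun h => h
  have htr : A 0 0 + A 1 1 = 0 := by
    have : A.trace = 0 := hA
    simpa [Matrix.trace_fin_two] using this
  let E : LieAlgebra.SpecialLinear.sl (Fin 2) ℝ :=
    ⟨!![0, 1; 0, 0], mem (by simp [Matrix.trace_fin_two])⟩
  let F : LieAlgebra.SpecialLinear.sl (Fin 2) ℝ :=
    ⟨!![0, 0; 1, 0], mem (by simp [Matrix.trace_fin_two])⟩
  let H : LieAlgebra.SpecialLinear.sl (Fin 2) ℝ :=
    ⟨!![1, 0; 0, -1], mem (by simp [Matrix.trace_fin_two])⟩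
  -- `⁅H, E⁆ = 2E`, `⁅H, F⁆ = -2F`, `⁅E, F⁆ = H`.
  have key : (⟨A, hA⟩ : LieAlgebra.SpecialLinear.sl (Fin 2) ℝ)
      = (A 0 1 / 2) • ⁅H, E⁆ + (-(A 1 0) / 2) • ⁅H, F⁆ + (A 0 0) • ⁅E, F⁆ := by
    apply Subtype.ext
    change A = (A 0 1 / 2) • (H.1 * E.1 - E.1 * H.1) + (-(A 1 0) / 2) • (H.1 * F.1 - F.1 * H.1)
      + (A 0 0) • (E.1 * F.1 - F.1 * E.1)
    ext i j
    fin_cases i <;> fin_cases j <;> simp [E, F, H] <;> linarith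
  rw [key]
  exact N.add_mem (N.add_mem (N.smul_mem _ (hN _ _)) (N.smul_mem _ (hN _ _)))
    (N.smul_mem _ (hN _ _))

theorem isPerfectLie_so_three : IsPerfectLie (LieAlgebra.Orthogonal.so (Fin 3) ℝ) := by
  intro N hN
  rw [eq_top_iff]
  rintro ⟨A, hA⟩ -
  have hA' := (LieAlgebra.Orthogonal.mem_so (Fin 3) ℝ A).1 hA
  have skew : ∀ i j, A j i = -A i j := fun i j => congrFun (congrFun hA' i) j
  have h00 := skew 0 0
  have h11 := skew 1 1
  have h22 := skew 2 2
  have h01 := skew 0 1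
  have h02 := skew 0 2
  have h12 := skew 1 2
  let X : LieAlgebra.Orthogonal.so (Fin 3) ℝ :=
    ⟨!![0, 0, 0; 0, 0, -1; 0, 1, 0], (LieAlgebra.Orthogonal.mem_so _ _ _).2 (by
      ext i j; fin_cases i <;> fin_cases j <;> simp)⟩
  let Y : LieAlgebra.Orthogonal.so (Fin 3) ℝ :=
    ⟨!![0, 0, 1; 0, 0, 0; -1, 0, 0], (LieAlgebra.Orthogonal.mem_so _ _ _).2 (by
      ext i j; fin_cases i <;> fin_cases j <;> simp)⟩
  let Z : LieAlgebra.Orthogonal.so (Fin 3) ℝ :=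
    ⟨!![0, -1, 0; 1, 0, 0; 0, 0, 0], (LieAlgebra.Orthogonal.mem_so _ _ _).2 (by
      ext i j; fin_cases i <;> fin_cases j <;> simp)⟩
  -- `X`, `Y`, `Z` generate the rotations about the axes, and `⁅Y, Z⁆ = X` cyclically.
  have key : (⟨A, hA⟩ : LieAlgebra.Orthogonal.so (Fin 3) ℝ)
      = (-(A 1 2)) • ⁅Y, Z⁆ + (A 0 2) • ⁅Z, X⁆ + (-(A 0 1)) • ⁅X, Y⁆ := by
    apply Subtype.ext
    change A = (-(A 1 2)) • (Y.1 * Z.1 - Z.1 * Y.1) + (A 0 2) • (Z.1 * X.1 - X.1 * Z.1)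
      + (-(A 0 1)) • (X.1 * Y.1 - Y.1 * X.1)
    ext i j
    fin_cases i <;> fin_cases j <;>
      simp [X, Y, Z] <;> linarith
  rw [key]
  exact N.add_mem (N.add_mem (N.smul_mem _ (hN _ _)) (N.smul_mem _ (hN _ _)))
    (N.smul_mem _ (hN _ _))

/-! ### Perfect algebras of smooth fields. -/

section Fields

variable {Ω : TopologicalSpace.Opens TXU}

theorem fderiv_smoothField_apply (V : SmoothField Ω) {p : TXU} (hp : p ∈ Ω) (v : TXU) :
    fderiv ℝ V p v
      = (fderiv ℝ (coeffT V) p v, fderiv ℝ (coeffX V) p v, fderiv ℝ (coeffU V) p v) := by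
  have h := (V.differentiableAt hp).hasFDerivAt
  have e1 : fderiv ℝ (coeffT V) p v = (fderiv ℝ V p v).1 :=
    congrArg (fun T : TXU →L[ℝ] ℝ => T v) h.fst.fderiv
  have e2 : fderiv ℝ (coeffX V) p v = (fderiv ℝ V p v).2.1 :=
    congrArg (fun T : TXU →L[ℝ] ℝ => T v) h.snd.fst.fderiv
  have e3 : fderiv ℝ (coeffU V) p v = (fderiv ℝ V p v).2.2 :=
    congrArg (fun T : TXU →L[ℝ] ℝ => T v) h.snd.snd.fderiv
  rw [e1, e2, e3]

theorem coeffT_lie (V W : SmoothField Ω) {p : TXU} (hp : p ∈ Ω) :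
    coeffT (⁅V, W⁆ : SmoothField Ω) p
      = fderiv ℝ (coeffT W) p (coeffT V p, coeffX V p, coeffU V p)
        - fderiv ℝ (coeffT V) p (coeffT W p, coeffX W p, coeffU W p) := by
  rw [coeffT, SmoothField.bracket_apply V W hp, fderiv_smoothField_apply W hp,
    fderiv_smoothField_apply V hp]
  rfl

theorem coeffX_lie (V W : SmoothField Ω) {p : TXU} (hp : p ∈ Ω) :
    coeffX (⁅V, W⁆ : SmoothField Ω) p
      = fderiv ℝ (coeffX W) p (coeffT V p, coeffX V p, coeffU V p)
        - fderiv ℝ (coeffX V) p (coeffT W p, coeffX W p, coeffU W p) := by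
  rw [coeffX, SmoothField.bracket_apply V W hp, fderiv_smoothField_apply W hp,
    fderiv_smoothField_apply V hp]
  rfl

theorem coeffU_lie (V W : SmoothField Ω) {p : TXU} (hp : p ∈ Ω) :
    coeffU (⁅V, W⁆ : SmoothField Ω) p
      = fderiv ℝ (coeffU W) p (coeffT V p, coeffX V p, coeffU V p)
        - fderiv ℝ (coeffU V) p (coeffT W p, coeffX W p, coeffU W p) := by
  rw [coeffU, SmoothField.bracket_apply V W hp, fderiv_smoothField_apply W hp,
    fderiv_smoothField_apply V hp]
  rfl

theorem fderiv_smoothField_add (V W : SmoothField Ω) {p : TXU} (hp : p ∈ Ω) :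
    fderiv ℝ (V + W : SmoothField Ω) p = fderiv ℝ V p + fderiv ℝ W p :=
  fderiv_add (V.differentiableAt hp) (W.differentiableAt hp)

theorem fderiv_smoothField_smul (c : ℝ) (V : SmoothField Ω) {p : TXU} (hp : p ∈ Ω) :
    fderiv ℝ (c • V : SmoothField Ω) p = c • fderiv ℝ V p :=
  fderiv_const_smul (V.differentiableAt hp) c

/-- The derivative at `p` in the direction `v`, as a linear map on smooth fields. -/
noncomputable def fderivAt {p : TXU} (hp : p ∈ Ω) (v : TXU) : SmoothField Ω →ₗ[ℝ] TXU where
  toFun V := fderiv ℝ V p v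
  map_add' V W := by rw [fderiv_smoothField_add V W hp]; rfl
  map_smul' c V := by rw [fderiv_smoothField_smul c V hp]; rfl

/-- Evaluation at `p`, as a linear map on smooth fields. -/
def evalAt (p : TXU) : SmoothField Ω →ₗ[ℝ] TXU where
  toFun V := V p
  map_add' _ _ := rfl
  map_smul' _ _ := rfl

/-- If `G` and `H` have vanishing second derivative in the direction `v`, then their Wronskian
in this direction has vanishing derivative. -/
theorem dirDeriv_wronskian_eq_zero {S : Set TXU} (hS : IsOpen S) {G H : TXU → ℝ}
    (hG : ContDiffOn ℝ ∞ G S) (hH : ContDiffOn ℝ ∞ H S) (v : TXU) {p : TXU} (hp : p ∈ S)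
    (hGG : dirDeriv v (dirDeriv v G) p = 0) (hHH : dirDeriv v (dirDeriv v H) p = 0) :
    dirDeriv v (fun q => G q * dirDeriv v H q - H q * dirDeriv v G q) p = 0 := by
  have dG := (hG.differentiableAt_of_isOpen hS hp).hasFDerivAt
  have dH := (hH.differentiableAt_of_isOpen hS hp).hasFDerivAt
  have dG' := ((dirDeriv_contDiffOn hS hG v).differentiableAt_of_isOpen hS hp).hasFDerivAt
  have dH' := ((dirDeriv_contDiffOn hS hH v).differentiableAt_of_isOpen hS hp).hasFDerivAt
  have e1 : fderiv ℝ (dirDeriv v G) p v = 0 := hGG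
  have e2 : fderiv ℝ (dirDeriv v H) p v = 0 := hHH
  refine (congrArg (fun T : TXU →L[ℝ] ℝ => T v) ((dG.mul dH').sub (dH.mul dG')).fderiv).trans ?_
  simp [e1, e2, dirDeriv]
  ring

/-- Perfectness is used once per coefficient or derivative, in the order `τ_t`, `τ`, `ξ`, `η_u`,
`η`: each vanishing makes the next functional kill commutators. -/
theorem IsPerfectLie.eq_zero_of_isAffineOn {L : Type*} [LieRing L] [LieAlgebra ℝ L]
    (hL : IsPerfectLie L) (φ : L →ₗ⁅ℝ⁆ SmoothField Ω) {S : Set TXU} (hS : IsOpen S)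
    (hSΩ : S ⊆ Ω) (h : ∀ y, IsAffineOn S (φ y)) (y : L) {p : TXU} (hp : p ∈ S) : φ y p = 0 := by
  have hTT : ∀ y, ContDiffOn ℝ ∞ (coeffT (φ y)) S := fun y => (coeffT_contDiffOn (φ y)).mono hSΩ
  have hUU : ∀ y, ContDiffOn ℝ ∞ (coeffU (φ y)) S := fun y => (coeffU_contDiffOn (φ y)).mono hSΩ
  have lieT : ∀ y z, ∀ p ∈ S, coeffT (φ ⁅y, z⁆) p
      = coeffT (φ y) p * ∂t (coeffT (φ z)) p - coeffT (φ z) p * ∂t (coeffT (φ y)) p := by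
    intro y z p hp
    rw [LieHom.map_lie, coeffT_lie _ _ (hSΩ hp), fderiv_eq_dirDeriv, fderiv_eq_dirDeriv,
      (h y).Tx p hp, (h y).Tu p hp, (h z).Tx p hp, (h z).Tu p hp]
    ring
  have lieX : ∀ y z, ∀ p ∈ S, coeffX (φ ⁅y, z⁆) p
      = coeffX (φ y) p * ∂x (coeffX (φ z)) p - coeffX (φ z) p * ∂x (coeffX (φ y)) p := by
    intro y z p hp
    rw [LieHom.map_lie, coeffX_lie _ _ (hSΩ hp), fderiv_eq_dirDeriv, fderiv_eq_dirDeriv,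
      (h y).Xt p hp, (h y).Xu p hp, (h z).Xt p hp, (h z).Xu p hp]
    ring
  have hTt : ∀ y, ∀ p ∈ S, ∂t (coeffT (φ y)) p = 0 := by
    intro y p hp
    have key := hL.linearMap_eq_zero
      ((LinearMap.fst ℝ ℝ (ℝ × ℝ)).comp ((fderivAt (hSΩ hp) (1, 0, 0)).comp (φ : L →ₗ[ℝ] SmoothField Ω)))
      (fun y z => by
        change (fderiv ℝ (φ ⁅y, z⁆) p (1, 0, 0)).1 = 0
        rw [fderiv_smoothField_apply _ (hSΩ hp)]
        exact (dirDeriv_eqOn hS (lieT y z) (1, 0, 0) hp).trans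
          (dirDeriv_wronskian_eq_zero hS (hTT y) (hTT z) _ hp ((h y).Ttt p hp)
            ((h z).Ttt p hp))) y
    change (fderiv ℝ (φ y) p (1, 0, 0)).1 = 0 at key
    rwa [fderiv_smoothField_apply _ (hSΩ hp)] at key
  have hT : ∀ y, ∀ p ∈ S, coeffT (φ y) p = 0 := fun y p hp =>
    hL.linearMap_eq_zero
      ((LinearMap.fst ℝ ℝ (ℝ × ℝ)).comp ((evalAt (Ω := Ω) p).comp (φ : L →ₗ[ℝ] SmoothField Ω)))
      (fun y z => (lieT y z p hp).trans (by rw [hTt y p hp, hTt z p hp]; ring)) y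
  have hX : ∀ y, ∀ p ∈ S, coeffX (φ y) p = 0 := fun y p hp =>
    hL.linearMap_eq_zero
      ((LinearMap.fst ℝ ℝ ℝ).comp ((LinearMap.snd ℝ ℝ (ℝ × ℝ)).comp
        ((evalAt (Ω := Ω) p).comp (φ : L →ₗ[ℝ] SmoothField Ω))))
      (fun y z => (lieX y z p hp).trans (by
        rw [← (h y).TtXx p hp, ← (h z).TtXx p hp, hTt y p hp, hTt z p hp]; ring)) y
  -- With `τ = ξ = 0` throughout `S`, the fields act in the `u` direction only, so the bracket of
  -- the `η`'s is again a Wronskian.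
  have lieU : ∀ y z, ∀ p ∈ S, coeffU (φ ⁅y, z⁆) p
      = coeffU (φ y) p * ∂u (coeffU (φ z)) p - coeffU (φ z) p * ∂u (coeffU (φ y)) p := by
    intro y z p hp
    rw [LieHom.map_lie, coeffU_lie _ _ (hSΩ hp), fderiv_eq_dirDeriv, fderiv_eq_dirDeriv,
      hT y p hp, hT z p hp, hX y p hp, hX z p hp]
    ring
  have hUu : ∀ y, ∀ p ∈ S, ∂u (coeffU (φ y)) p = 0 := by
    intro y p hp
    have key := hL.linearMap_eq_zero
      ((LinearMap.snd ℝ ℝ ℝ).comp ((LinearMap.snd ℝ ℝ (ℝ × ℝ)).comp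
        ((fderivAt (hSΩ hp) (0, 0, 1)).comp (φ : L →ₗ[ℝ] SmoothField Ω))))
      (fun y z => by
        change (fderiv ℝ (φ ⁅y, z⁆) p (0, 0, 1)).2.2 = 0
        rw [fderiv_smoothField_apply _ (hSΩ hp)]
        exact (dirDeriv_eqOn hS (lieU y z) (0, 0, 1) hp).trans
          (dirDeriv_wronskian_eq_zero hS (hUU y) (hUU z) _ hp ((h y).Uuu p hp)
            ((h z).Uuu p hp))) y
    change (fderiv ℝ (φ y) p (0, 0, 1)).2.2 = 0 at key
    rwa [fderiv_smoothField_apply _ (hSΩ hp)] at key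
  have hU : coeffU (φ y) p = 0 :=
    hL.linearMap_eq_zero
      ((LinearMap.snd ℝ ℝ ℝ).comp ((LinearMap.snd ℝ ℝ (ℝ × ℝ)).comp
        ((evalAt (Ω := Ω) p).comp (φ : L →ₗ[ℝ] SmoothField Ω))))
      (fun y z => (lieU y z p hp).trans (by rw [hUu y p hp, hUu z p hp]; ring)) y
  exact Prod.ext (hT y p hp) (Prod.ext (hX y p hp) hU)

/-- A perfect finite-dimensional Lie algebra of smooth fields all of whose members vanish to first
order at a point of a connected open set vanishes there. -/
theorem IsPerfectLie.eq_zero_of_jet_eq_zero (hΩ : IsPreconnected (Ω : Set TXU)) {L : Type*}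
    [LieRing L] [LieAlgebra ℝ L] [FiniteDimensional ℝ L] (hL : IsPerfectLie L)
    (φ : L →ₗ⁅ℝ⁆ SmoothField Ω) {p₀ : TXU} (hp₀ : p₀ ∈ Ω)
    (h₀ : ∀ y, φ y p₀ = 0 ∧ fderiv ℝ (φ y) p₀ = 0) (y : L) : φ y = 0 := by
  let b := Module.finBasis ℝ L
  -- Up to constants depending on `y`, `N` and `M` bound the value and the derivative of every `φ
  -- y`.
  let N : TXU → ℝ := fun p => ∑ i, ‖φ (b i) p‖
  let M : TXU → ℝ := fun p => ∑ i, ‖fderiv ℝ (φ (b i)) p‖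
  have N_nonneg : ∀ p, 0 ≤ N p := fun p => Finset.sum_nonneg fun _ _ => norm_nonneg _
  have M_nonneg : ∀ p, 0 ≤ M p := fun p => Finset.sum_nonneg fun _ _ => norm_nonneg _
  have sum_bound : ∀ {E : Type} [SeminormedAddCommGroup E] [NormedSpace ℝ E] (T : L →ₗ[ℝ] E)
      (y : L), ‖T y‖ ≤ (∑ i, ‖b.repr y i‖) * ∑ i, ‖T (b i)‖ := by
    intro E _ _ T y
    conv_lhs => rw [← b.sum_repr y, map_sum]
    refine (norm_sum_le _ _).trans ?_
    rw [Finset.sum_mul]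
    refine Finset.sum_le_sum fun i _ => ?_
    rw [map_smul, norm_smul]
    exact mul_le_mul_of_nonneg_left
      (Finset.single_le_sum (f := fun i => ‖T (b i)‖) (fun _ _ => norm_nonneg _)
        (Finset.mem_univ i)) (norm_nonneg _)
  have boundN : ∀ y, ∃ C, 0 ≤ C ∧ ∀ p, ‖φ y p‖ ≤ C * N p := fun y =>
    ⟨_, Finset.sum_nonneg fun _ _ => norm_nonneg _,
      fun p => sum_bound ((evalAt (Ω := Ω) p).comp (φ : L →ₗ[ℝ] SmoothField Ω)) y⟩
  have boundM : ∀ y, ∃ C, 0 ≤ C ∧ ∀ p ∈ Ω, ‖fderiv ℝ (φ y) p‖ ≤ C * M p := fun y =>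
    ⟨_, Finset.sum_nonneg fun _ _ => norm_nonneg _, fun p hp => by
      let T : SmoothField Ω →ₗ[ℝ] (TXU →L[ℝ] TXU) :=
        { toFun := fun V => fderiv ℝ V p
          map_add' := fun V W => fderiv_smoothField_add V W hp
          map_smul' := fun c V => fderiv_smoothField_smul c V hp }
      exact sum_bound (T.comp (φ : L →ₗ[ℝ] SmoothField Ω)) y⟩
  -- A commutator is bilinear in values and first derivatives, hence `O(M N)`; by perfectness every
  -- element inherits this bound.
  have boundNM : ∀ y, ∃ C, ∀ p ∈ Ω, ‖φ y p‖ ≤ C * (M p * N p) := by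
    refine hL.induction ⟨0, fun p _ => ?_⟩ ?_ ?_ ?_
    · rw [map_zero, SmoothField.zero_apply, norm_zero, zero_mul]
    · rintro x y ⟨C, hC⟩ ⟨D, hD⟩
      refine ⟨C + D, fun p hp => ?_⟩
      rw [map_add, SmoothField.add_apply, add_mul]
      exact (norm_add_le _ _).trans (add_le_add (hC p hp) (hD p hp))
    · rintro c x ⟨C, hC⟩
      refine ⟨‖c‖ * C, fun p hp => ?_⟩
      rw [map_smul, SmoothField.smul_apply, norm_smul, mul_assoc]
      exact mul_le_mul_of_nonneg_left (hC p hp) (norm_nonneg _)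
    · intro x y
      obtain ⟨Cx, hCx, hx⟩ := boundN x
      obtain ⟨Cy, hCy, hy⟩ := boundN y
      obtain ⟨Dx, hDx, hx'⟩ := boundM x
      obtain ⟨Dy, hDy, hy'⟩ := boundM y
      refine ⟨Dy * Cx + Dx * Cy, fun p hp => ?_⟩
      rw [LieHom.map_lie, SmoothField.bracket_apply _ _ hp]
      have h1 : ‖fderiv ℝ (φ y) p (φ x p)‖ ≤ (Dy * M p) * (Cx * N p) :=
        ((fderiv ℝ (φ y) p).le_opNorm _).trans
          (mul_le_mul (hy' p hp) (hx p) (norm_nonneg _) (mul_nonneg hDy (M_nonneg p)))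
      have h2 : ‖fderiv ℝ (φ x) p (φ y p)‖ ≤ (Dx * M p) * (Cy * N p) :=
        ((fderiv ℝ (φ x) p).le_opNorm _).trans
          (mul_le_mul (hx' p hp) (hy p) (norm_nonneg _) (mul_nonneg hDx (M_nonneg p)))
      refine (norm_sub_le _ _).trans ((add_le_add h1 h2).trans (le_of_eq ?_))
      ring
  choose C hC using fun i => boundNM (b i)
  have hNMN : ∀ p ∈ Ω, N p ≤ ((∑ i, C i) * M p) * N p := fun p hp => by
    rw [mul_assoc, Finset.sum_mul]
    exact Finset.sum_le_sum fun i _ => hC i p hp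
  have cont : ∀ y, ContinuousOn (φ y) Ω := fun y => (φ y).2.1.continuousOn
  have cont' : ∀ y, ContinuousOn (fderiv ℝ (φ y)) Ω := fun y =>
    (φ y).2.1.continuousOn_fderiv_of_isOpen Ω.isOpen (by simp)
  have contM : ContinuousOn M Ω := continuousOn_finsetSum _ fun i _ => (cont' (b i)).norm
  -- Vanishing of values alone would not propagate: the linear action of `sl(2)` vanishes at the
  -- origin.
  let Z : Set TXU := {p | N p = 0 ∧ M p = 0}
  have zero_of_N : ∀ p, N p = 0 → ∀ y, φ y p = 0 := fun p hp y => by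
    obtain ⟨C, -, h⟩ := boundN y
    have := h p
    rw [hp, mul_zero] at this
    exact norm_le_zero_iff.1 this
  -- As `M` is continuous and zero at `p`, nearby `N ≤ (∑ C) M N` has a factor below `1`, forcing `N
  -- = 0`.
  have near : ∀ p ∈ Ω, p ∈ Z → ∀ᶠ q in nhds p, q ∈ Ω ∧ N q = 0 := by
    intro p hp hpZ
    have hc : ContinuousAt (fun q => (∑ i, C i) * M q) p :=
      (contM.continuousAt (Ω.isOpen.mem_nhds hp)).const_mul _
    have hlt : ∀ᶠ q in nhds p, (∑ i, C i) * M q < 1 :=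
      hc.eventually_lt_const (by
        change (∑ i, C i) * M p < 1
        rw [hpZ.2, mul_zero]
        exact one_pos)
    filter_upwards [hlt, Ω.isOpen.mem_nhds hp] with q hq hqΩ
    refine ⟨hqΩ, le_antisymm ?_ (N_nonneg q)⟩
    have := hNMN q hqΩ
    nlinarith [N_nonneg q]
  -- `N = 0` on a whole neighbourhood makes the derivatives vanish there too, so `M = 0` as well.
  have openZ : IsOpen ((Ω : Set TXU) ∩ Z) := by
    rw [isOpen_iff_eventually]
    rintro p ⟨hp, hpZ⟩
    filter_upwards [(near p hp hpZ).eventually_nhds] with q hq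
    refine ⟨hq.self_of_nhds.1, hq.self_of_nhds.2, Finset.sum_eq_zero fun i _ => ?_⟩
    have : φ (b i) =ᶠ[nhds q] fun _ => (0 : TXU) :=
      hq.mono fun r hr => zero_of_N r hr.2 (b i)
    rw [this.fderiv_eq, fderiv_const_apply, norm_zero]
  have contN : ContinuousOn N Ω := continuousOn_finsetSum _ fun i _ => (cont (b i)).norm
  have openZc : IsOpen ((Ω : Set TXU) ∩ Zᶜ) := by
    have h1 : IsOpen ((Ω : Set TXU) ∩ (fun p => (N p, M p)) ⁻¹' {0}ᶜ) :=
      (contN.prodMk contM).isOpen_inter_preimage Ω.isOpen isOpen_compl_singleton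
    have h2 : (fun p => (N p, M p)) ⁻¹' {0}ᶜ = Zᶜ := by
      ext p
      simp [Z, Prod.ext_iff]
    rwa [h2] at h1
  have hp₀Z : p₀ ∈ Z :=
    ⟨Finset.sum_eq_zero fun i _ => by rw [(h₀ (b i)).1, norm_zero],
      Finset.sum_eq_zero fun i _ => by rw [(h₀ (b i)).2, norm_zero]⟩
  have hsub : (Ω : Set TXU) ⊆ (Ω : Set TXU) ∩ Z := by
    refine hΩ.subset_left_of_subset_union openZ openZc ?_ ?_ ⟨p₀, hp₀, hp₀, hp₀Z⟩
    · exact Set.disjoint_left.2 fun p hp hp' => hp'.2 hp.2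
    · intro p hp
      by_cases hpZ : p ∈ Z
      · exact Or.inl ⟨hp, hpZ⟩
      · exact Or.inr ⟨hp, hpZ⟩
  ext1 p hp
  exact zero_of_N p (hsub hp).2.1 y

theorem IsPerfectLie.lieHom_eq_zero (hΩ : IsPreconnected (Ω : Set TXU)) {L : Type*}
    [LieRing L] [LieAlgebra ℝ L] [FiniteDimensional ℝ L] (hL : IsPerfectLie L)
    (φ : L →ₗ⁅ℝ⁆ SmoothField Ω) {S : Set TXU} (hS : IsOpen S) (hSΩ : S ⊆ Ω) (hne : S.Nonempty)
    (h : ∀ y, IsAffineOn S (φ y)) (y : L) : φ y = 0 := by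
  obtain ⟨p, hp⟩ := hne
  refine hL.eq_zero_of_jet_eq_zero hΩ φ (hSΩ hp) (fun y => ?_) y
  have hz : ∀ q ∈ S, φ y q = 0 := fun q hq => hL.eq_zero_of_isAffineOn φ hS hSΩ h y hq
  refine ⟨hz p hp, ?_⟩
  have : φ y =ᶠ[nhds p] fun _ => (0 : TXU) :=
    Filter.eventuallyEq_of_mem (hS.mem_nhds hp) hz
  rw [this.fderiv_eq, fderiv_const_apply]

end Fields

/-! ### Conclusion. -/

theorem mainTheorem6 (Ω : TopologicalSpace.Opens TXU) (hΩ : IsConnected (Ω : Set TXU)) :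
    (∀ f g : TXU → ℝ, ContDiffOn ℝ ∞ f Ω → ContDiffOn ℝ ∞ g Ω →
      (∃ p ∈ Ω, fderiv ℝ g p (0, 0, 1) ≠ 0) →
      ¬ ∃ L : LieSubalgebra ℝ (SmoothField Ω),
        (L : Set (SmoothField Ω)) ⊆ invarianceAlgebra Ω f g ∧
          Nontrivial L ∧ FiniteDimensional ℝ L ∧ LieAlgebra.IsSemisimple ℝ L) ∧
    (¬ ∃ φ : LieAlgebra.Orthogonal.so (Fin 3) ℝ →ₗ⁅ℝ⁆ SmoothField Ω,
        Function.Injective φ ∧ ∀ y, IsAdmissibleOperator (φ y)) ∧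
    (¬ ∃ φ : LieAlgebra.SpecialLinear.sl (Fin 2) ℝ →ₗ⁅ℝ⁆ SmoothField Ω,
        Function.Injective φ ∧ ∀ y, IsAdmissibleOperator (φ y)) := by
  refine ⟨?_, ?_, ?_⟩
  · rintro f g hf hg ⟨p, hp, hgp⟩ ⟨L, hLI, hnt, hfd, hss⟩
    have hS : IsOpen ((Ω : Set TXU) ∩ dirDeriv (0, 0, 1) g ⁻¹' {0}ᶜ) :=
      (dirDeriv_contDiffOn Ω.isOpen hg (0, 0, 1)).continuousOn.isOpen_inter_preimage Ω.isOpen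
        isOpen_compl_singleton
    obtain ⟨y, hy⟩ := exists_ne (0 : L)
    have hL : IsPerfectLie L := LieAlgebra.IsSemisimple.isPerfectLie
    have h0 : L.incl y = 0 := hL.lieHom_eq_zero hΩ.isPreconnected L.incl hS
      Set.inter_subset_left ⟨p, hp, hgp⟩
      (fun y => IsInvarianceOperator.isAffineOn hf hg (hLI y.2) hS Set.inter_subset_left
        fun q hq => hq.2) y
    exact hy (Subtype.ext h0)
  · rintro ⟨φ, hinj, hφ⟩
    let A : LieAlgebra.Orthogonal.so (Fin 3) ℝ :=
      ⟨!![0, -1, 0; 1, 0, 0; 0, 0, 0], (LieAlgebra.Orthogonal.mem_so _ _ _).2 (by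
        ext i j; fin_cases i <;> fin_cases j <;> simp)⟩
    have : FiniteDimensional ℝ (LieAlgebra.Orthogonal.so (Fin 3) ℝ) :=
      inferInstance
    have h0 : φ A = 0 := isPerfectLie_so_three.lieHom_eq_zero hΩ.isPreconnected φ Ω.isOpen
      subset_rfl hΩ.nonempty (fun y => (hφ y).isAffineOn) A
    have hA : A = 0 := hinj (h0.trans (map_zero φ).symm)
    have h10 : (1 : ℝ) = 0 := congrFun (congrFun (congrArg Subtype.val hA) 1) 0
    exact one_ne_zero h10
  · rintro ⟨φ, hinj, hφ⟩
    have hmem : (!![0, 1; 0, 0] : Matrix (Fin 2) (Fin 2) ℝ).trace = 0 := by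
      simp [Matrix.trace_fin_two]
    let A : LieAlgebra.SpecialLinear.sl (Fin 2) ℝ := ⟨!![0, 1; 0, 0], hmem⟩
    have : FiniteDimensional ℝ (LieAlgebra.SpecialLinear.sl (Fin 2) ℝ) :=
      inferInstance
    have h0 : φ A = 0 := isPerfectLie_sl_two.lieHom_eq_zero hΩ.isPreconnected φ Ω.isOpen
      subset_rfl hΩ.nonempty (fun y => (hφ y).isAffineOn) A
    have hA : A = 0 := hinj (h0.trans (map_zero φ).symm)
    have h10 : (1 : ℝ) = 0 := congrFun (congrFun (congrArg Subtype.val hA) 0) 1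
    exact one_ne_zero h10
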